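/- **Asymptotic convergence for min-polynomials.** Let $m\ge 0$, $L\ge 0$, $K\ge1$, $N\ge1$ be integers, let $h_1,\dots,h_L,\ g_1^{(1)},\dots,g_1^{(K)}\in\mathbb{R}[\xi]$ be real polynomials in $\xi=(\xi_1,\dots,\xi_m)$, and let $\Xi=\{\xi\in\mathbb{R}^m : h_\ell(\xi)\ge 0,\ \ell=1,\dots,L\}$. Let $\Sigma^2$ be the set of finite sums of squares of polynomials in $\mathbb{R}[\xi]$ and $\Sigma^2_{d}$ the set of $f\in\Sigma^2$ of degree at most $d$. Assume the Archimedean condition: there are $R\in\mathbb{N}$ and $\sigma_0,\dots,\sigma_L\in\Sigma^2$ with $R-\|\xi\|_2^2=\sigma_0+\sum_{\ell=1}^L\sigma_\ell h_\ell$ (so that $\Xi$ is compact). Let $\widehat\xi_1,\dots,\widehat\xi_N\in\Xi$, let $\widehat{\mathbb{P}}=\frac1N\sum_{i=1}^N\delta_{\widehat\xi_i}$, let $\varepsilon>0$, and let $\mathbb{B}_\varepsilon(\widehat{\mathbb{P}})$ be the set of Borel probability measures $\mathbb{Q}$ on $\Xi$ with $d_W(\mathbb{Q},\widehat{\mathbb{P}})\le\varepsilon$,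 where $$d_W(\mathbb{Q},\mathbb{P})=\inf_{\Pi}\Big(\int_{\Xi\times\Xi}\|\xi-\xi'\|_2^2\,\Pi(d\xi,d\xi')\Big)^{1/2}$$ and $\Pi$ runs over all probability measures on $\Xi\times\Xi$ with marginals $\mathbb{Q}$ and $\mathbb{P}$. For $r\in\mathbb{N}$ let $v_r\in[-\infty,\infty]$ be the optimal value (the supremum, and $-\infty$ if there is no feasible point) of the problem $$(\widetilde{\mathrm{AD}}_r)\qquad \sup\ -\lambda\varepsilon^2+\frac1N\sum_{i=1}^N\alpha_i$$ over all $\lambda\ge0$, $\alpha_i\in\mathbb{R}$ and $\sigma_{\ell,i}^{(k)}\in\Sigma^2$ such that, for all $k\in\{1,\dots,K\}$, $\ell\in\{1,\dots,L\}$ and $i\in\{1,\dots,N\}$, $$g_1^{(k)}+\lambda\|\xi-\widehat\xi_i\|_2^2-\alpha_i-\sum_{\ell'=1}^L\sigma_{\ell',i}^{(k)}h_{\ell'}\in\Sigma^2_{2r},\qquad \deg\big(\sigma_{\ell,i}^{(k)}h_\ell\big)\le 2r .$$ Then the minimum $$v=\min_{\mathbb{Q}\in\mathbb{B}_\varepsilon(\widehat{\mathbb{P}})}\int_\Xi\min_{k=1,\dots,K}g_1^{(k)}(\xi)\,\mathbb{Q}(d\xi)$$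 is attained, $v_r\le v_{r+1}\le v$ for all $r\in\mathbb{N}$, and $\lim_{r\to\infty}v_r=v$. -/

import Mathlib

open MeasureTheory Filter Topology
open scoped ENNReal

noncomputable section

namespace WassersteinSOS

variable {m K L N : ℕ}

/-- The basic semi-algebraic set `Ξ = {ξ ∈ ℝᵐ : h_ℓ(ξ) ≥ 0 for all ℓ}`. -/
def supportSet (h : Fin L → MvPolynomial (Fin m) ℝ) : Set (EuclideanSpace ℝ (Fin m)) :=
  {ξ | ∀ l, 0 ≤ MvPolynomial.eval (fun j => ξ j) (h l)}

/-- The quadratic module `Q(h₁, …, h_L) = {σ₀ + ∑ σ_ℓ h_ℓ : σ₀, …, σ_L sums of squares}`. -/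
def quadraticModule (h : Fin L → MvPolynomial (Fin m) ℝ) : Set (MvPolynomial (Fin m) ℝ) :=
  {f | ∃ (σ₀ : MvPolynomial (Fin m) ℝ) (σ : Fin L → MvPolynomial (Fin m) ℝ),
    IsSumSq σ₀ ∧ (∀ l, IsSumSq (σ l)) ∧ f = σ₀ + ∑ l, σ l * h l}

/-- The Archimedean condition: `R - ‖ξ‖₂² ∈ Q(h₁, …, h_L)` for some natural number `R`. -/
def ArchimedeanCondition (h : Fin L → MvPolynomial (Fin m) ℝ) : Prop :=
  ∃ R : ℕ, MvPolynomial.C (R : ℝ) - ∑ j, MvPolynomial.X j ^ 2 ∈ quadraticModule h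

/-- The set `Σ²_d(ξ)` of sums of squares of polynomials that have degree at most `d`. -/
def sosOfDegreeLE (m d : ℕ) : Set (MvPolynomial (Fin m) ℝ) :=
  {f | IsSumSq f ∧ f.totalDegree ≤ d}

/-- The quadratic Wasserstein distance of two Borel probability measures on `Ξ ⊆ ℝᵐ`: the infimum
over all joint distributions `γ` on `Ξ × Ξ` with marginals `Q` and `P`. -/
def wassersteinDist {Ξ : Set (EuclideanSpace ℝ (Fin m))} (Q P : Measure Ξ) : ℝ≥0∞ :=
  ⨅ (γ : Measure (Ξ × Ξ)) (_ : γ.map Prod.fst = Q ∧ γ.map Prod.snd = P),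
    (∫⁻ z, ENNReal.ofReal (‖(z.1 : EuclideanSpace ℝ (Fin m)) - z.2‖ ^ 2) ∂γ) ^ (1 / 2 : ℝ)

/-- The empirical distribution `(1/N) ∑ δ_{ξ̂ᵢ}` of the sample `ξ̂₁, …, ξ̂_N ∈ Ξ`. -/
def empiricalMeasure {Ξ : Set (EuclideanSpace ℝ (Fin m))} (ξhat : Fin N → Ξ) : Measure Ξ :=
  (N : ℝ≥0∞)⁻¹ • ∑ i, Measure.dirac (ξhat i)

/-- The ball of radius `ε` around the empirical distribution, in the set of Borel probability
measures on `Ξ` with the quadratic Wasserstein distance. -/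
def wassersteinBall {Ξ : Set (EuclideanSpace ℝ (Fin m))} (ξhat : Fin N → Ξ) (ε : ℝ) :
    Set (ProbabilityMeasure Ξ) :=
  {Q | wassersteinDist (Q : Measure Ξ) (empiricalMeasure ξhat) ≤ ENNReal.ofReal ε}

/-- The loss `ξ ↦ min_k g_k(ξ)` (used for `K ≥ 1` only). -/
def minLoss (g : Fin K → MvPolynomial (Fin m) ℝ) (ξ : EuclideanSpace ℝ (Fin m)) : ℝ :=
  ⨅ k, MvPolynomial.eval (fun j => ξ j) (g k)

/-- The values `𝔼^Q[min_k g_k]` that the objective of the expectation problem takes on the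
Wasserstein ball. -/
def expectationValues (h : Fin L → MvPolynomial (Fin m) ℝ) (g : Fin K → MvPolynomial (Fin m) ℝ)
    (ξhat : Fin N → supportSet h) (ε : ℝ) : Set ℝ :=
  (fun Q : ProbabilityMeasure (supportSet h) => ∫ ξ, minLoss g ξ ∂(Q : Measure (supportSet h))) ''
    wassersteinBall ξhat ε

/-- The polynomial `φ(ξ) = ‖ξ - a‖₂²`. -/
def sqDistPoly (a : EuclideanSpace ℝ (Fin m)) : MvPolynomial (Fin m) ℝ :=
  ∑ j, (MvPolynomial.X j - MvPolynomial.C (a j)) ^ 2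

/-- Feasibility of `(lam, α, σ)` for the level `r` of the hierarchy. -/
def IsFeasible (h : Fin L → MvPolynomial (Fin m) ℝ) (g : Fin K → MvPolynomial (Fin m) ℝ)
    (ξhat : Fin N → supportSet h) (r : ℕ) (lam : ℝ) (α : Fin N → ℝ)
    (σ : Fin K → Fin L → Fin N → MvPolynomial (Fin m) ℝ) : Prop :=
  0 ≤ lam ∧ (∀ k l i, IsSumSq (σ k l i)) ∧
    (∀ k i, g k + MvPolynomial.C lam * sqDistPoly (ξhat i : EuclideanSpace ℝ (Fin m)) -
      MvPolynomial.C (α i) - ∑ l, σ k l i * h l ∈ sosOfDegreeLE m (2 * r)) ∧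
    (∀ k l i, (σ k l i * h l).totalDegree ≤ 2 * r)

/-- The optimal value of the level `r` of the hierarchy, as an extended real number: the supremum
of `-lam ε² + (1/N) ∑ αᵢ` over all feasible points, and `-∞` if there is none. -/
def hierarchyValue (h : Fin L → MvPolynomial (Fin m) ℝ) (g : Fin K → MvPolynomial (Fin m) ℝ)
    (ξhat : Fin N → supportSet h) (ε : ℝ) (r : ℕ) : EReal :=
  sSup {v : EReal | ∃ (lam : ℝ) (α : Fin N → ℝ)
    (σ : Fin K → Fin L → Fin N → MvPolynomial (Fin m) ℝ), IsFeasible h g ξhat r lam α σ ∧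
      v = ((-lam * ε ^ 2 + 1 / (N : ℝ) * ∑ i, α i : ℝ) : EReal)}

end WassersteinSOS

end

/-!
Lagrangian duality turns the expectation problem into polynomial positivity on `Ξ`, and Putinar's
Positivstellensatz turns positivity into feasibility for some level of the hierarchy.

*Duality.* Over the couplings `γ` of a law on `Ξ` with the empirical distribution, both the
transport cost and the expected loss are affine and continuous in `γ`, and the couplings form a
compact set. So the pairs (cost, loss) form a compact convex set in the plane, and the coupling of
least loss among those of cost at most `ε²` gives the minimum `v`. A separating line has finite
slope `-λ`, because the empirical distribution itself has cost `0 < ε²`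
(`exists_lagrangeMultiplier`). Testing the line on couplings that move each sample point `ξ̂ᵢ` to one
point `ξᵢ` gives `v ≤ -λ ε² + (1/N) ∑ min_ξ (min_k g_k(ξ) + λ ‖ξ - ξ̂ᵢ‖²)`
(`exists_coupling_and_multiplier`). Conversely every feasible point of the dual problem bounds the
expected loss on the whole ball from below (`neg_mul_add_average_le_integral`), which shows both that
`v` is the minimum and that no level of the hierarchy exceeds it.

*Positivity.* If the `αᵢ` are lowered slightly, each `g_k + λ ‖ξ - ξ̂ᵢ‖² - αᵢ` is positive on `Ξ` and
so lies in the quadratic module (`mem_quadraticModule_of_pos`). The proof of Putinar's theorem is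
elementary. Subtracting `∑ σ_ℓ h_ℓ` with `σ_ℓ = c (1 - c h_ℓ)ⁿ`, `n` large and even, makes the
polynomial positive on a whole cube (`exists_pos_sub_sum_penalty`). A polynomial positive on a cube
has positive Bernstein coefficients of high degree (`aeval_mem_of_pos_on_unitCube`), so it is a
combination of products of the functions `a ± xⱼ`. These lie in the quadratic module of the single
polynomial `a² - ‖x‖²`, which is closed under products (`singlePreorder`).
-/

namespace WassersteinSOS

/-! ### Bernstein expansions and positivity on the unit cube -/

/-- The Bernstein coefficient of degree `d` and index `ν` of the monomial `x ^ k`. -/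
noncomputable def bernsteinCoeff (d ν k : ℕ) : ℝ := (ν.choose k : ℝ) / d.choose k

lemma bernsteinCoeff_succ (d ν k : ℕ) :
    bernsteinCoeff d ν (k + 1) =
      bernsteinCoeff d ν k * (((ν - k : ℕ) : ℝ) / ((d - k : ℕ) : ℝ)) := by
  have key (n : ℕ) : (n.choose (k + 1) : ℝ) = n.choose k * ((n - k : ℕ) : ℝ) / (k + 1) := by
    rw [eq_div_iff (by positivity)]
    exact_mod_cast Nat.choose_succ_right_eq n k
  have hk : (k : ℝ) + 1 ≠ 0 := by positivity
  unfold bernsteinCoeff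
  rw [key, key, div_div_div_cancel_right₀ hk, mul_div_mul_comm]

lemma bernsteinCoeff_nonneg (d ν k : ℕ) : 0 ≤ bernsteinCoeff d ν k := by
  unfold bernsteinCoeff; positivity

lemma bernsteinCoeff_le_one {d ν : ℕ} (hν : ν ≤ d) (k : ℕ) : bernsteinCoeff d ν k ≤ 1 :=
  div_le_one_of_le₀ (by exact_mod_cast Nat.choose_le_choose k hν) (by positivity)

lemma abs_natSub_div_natSub_sub_le {d ν k : ℕ} (hν : ν ≤ d) (hk : k < d) :
    |((ν - k : ℕ) : ℝ) / ((d - k : ℕ) : ℝ) - (ν : ℝ) / d| ≤ (k : ℝ) / d := by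
  have hd : (0 : ℝ) < d := by exact_mod_cast (Nat.zero_le k).trans_lt hk
  rcases le_or_gt k ν with h | h
  · have hdk : (0 : ℝ) < d - k := sub_pos.2 (by exact_mod_cast hk)
    have hνd : (ν : ℝ) ≤ d := by exact_mod_cast hν
    have hkν : (k : ℝ) ≤ ν := by exact_mod_cast h
    have hk0 : (0 : ℝ) ≤ k := by positivity
    rw [Nat.cast_sub h, Nat.cast_sub hk.le]
    have e : ((ν : ℝ) - k) / (d - k) - ν / d = -((k / d) * ((d - ν) / (d - k))) := by
      field_simp; ring
    rw [e, abs_neg, abs_of_nonneg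
      (mul_nonneg (by positivity) (div_nonneg (by linarith) hdk.le))]
    exact mul_le_of_le_one_right (by positivity) ((div_le_one hdk).2 (by linarith))
  · rw [Nat.sub_eq_zero_of_le h.le, Nat.cast_zero, zero_div, zero_sub, abs_neg,
      abs_of_nonneg (by positivity)]
    gcongr

lemma abs_bernsteinCoeff_sub_pow_le {d ν k : ℕ} (hν : ν ≤ d) (hk : k ≤ d) :
    |bernsteinCoeff d ν k - ((ν : ℝ) / d) ^ k| ≤ (k : ℝ) ^ 2 / d := by
  induction k with
  | zero => simp [bernsteinCoeff]
  | succ k ih =>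
    have hd : (0 : ℝ) < d := by exact_mod_cast (Nat.zero_le k).trans_lt hk
    have ht0 : 0 ≤ (ν : ℝ) / d := by positivity
    have ht1 : (ν : ℝ) / d ≤ 1 := (div_le_one hd).2 (by exact_mod_cast hν)
    have e : bernsteinCoeff d ν (k + 1) - ((ν : ℝ) / d) ^ (k + 1) =
        bernsteinCoeff d ν k * (((ν - k : ℕ) : ℝ) / ((d - k : ℕ) : ℝ) - (ν : ℝ) / d) +
          (bernsteinCoeff d ν k - ((ν : ℝ) / d) ^ k) * ((ν : ℝ) / d) := by
      rw [bernsteinCoeff_succ]; ring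
    rw [e]
    refine (abs_add_le _ _).trans ?_
    rw [abs_mul, abs_mul, abs_of_nonneg (bernsteinCoeff_nonneg _ _ _), abs_of_nonneg ht0]
    have h1 := mul_le_mul (bernsteinCoeff_le_one hν k) (abs_natSub_div_natSub_sub_le hν hk)
      (abs_nonneg _) zero_le_one
    have h2 := mul_le_mul (ih (by omega)) ht1 ht0 (by positivity)
    refine (add_le_add h1 h2).trans ?_
    rw [one_mul, mul_one, ← add_div]
    gcongr
    push_cast
    nlinarith [(Nat.cast_nonneg k : (0 : ℝ) ≤ k)]

/-- The Bernstein expansion of a power, for elements `u`, `w` with `u + w = 1` of an algebra. -/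
lemma pow_eq_sum_bernsteinCoeff {A : Type*} [CommRing A] [Algebra ℝ A] {u w : A}
    (huw : u + w = 1) {d k : ℕ} (hk : k ≤ d) :
    u ^ k = ∑ ν : Fin (d + 1),
      algebraMap ℝ A (bernsteinCoeff d ν k) * (d.choose ν * (u ^ (ν : ℕ) * w ^ (d - ν))) := by
  have hd : (d.choose k : ℝ) ≠ 0 := by exact_mod_cast (Nat.choose_pos hk).ne'
  have hb (ν : ℕ) (hν : k ≤ ν) (hνd : ν ≤ d) :
      bernsteinCoeff d ν k * d.choose ν = ((d - k).choose (ν - k) : ℝ) := by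
    unfold bernsteinCoeff
    rw [div_mul_eq_mul_div, div_eq_iff hd, mul_comm, mul_comm _ (d.choose k : ℝ)]
    exact_mod_cast Nat.choose_mul hν
  rw [Fin.sum_univ_eq_sum_range (fun ν => algebraMap ℝ A (bernsteinCoeff d ν k) *
      (d.choose ν * (u ^ ν * w ^ (d - ν)))) (d + 1),
    show d + 1 = k + (d - k + 1) by omega, Finset.sum_range_add,
    Finset.sum_eq_zero (s := Finset.range k), zero_add]
  · calc u ^ k = u ^ k * (u + w) ^ (d - k) := by rw [huw, one_pow, mul_one]
      _ = _ := by
        rw [add_pow, Finset.mul_sum]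
        refine Finset.sum_congr rfl fun j hj => ?_
        have hj' : j ≤ d - k := by simpa [Nat.lt_succ_iff] using hj
        have h1 := hb (k + j) (by omega) (by omega)
        rw [show k + j - k = j by omega] at h1
        have h2 := congrArg (algebraMap ℝ A) h1
        rw [map_mul, map_natCast, map_natCast] at h2
        rw [← mul_assoc (algebraMap ℝ A _), h2, pow_add, show d - (k + j) = d - k - j by omega]
        ring
  · intro ν hν
    simp [bernsteinCoeff, Nat.choose_eq_zero_of_lt (Finset.mem_range.1 hν)]

lemma abs_prod_sub_prod_le_sum {ι : Type*} (s : Finset ι) (a b : ι → ℝ)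
    (ha : ∀ i, a i ∈ Set.Icc (0 : ℝ) 1) (hb : ∀ i, b i ∈ Set.Icc (0 : ℝ) 1) :
    |∏ i ∈ s, a i - ∏ i ∈ s, b i| ≤ ∑ i ∈ s, |a i - b i| := by
  classical
  induction s using Finset.induction_on with
  | empty => simp
  | insert j s hj ih =>
    rw [Finset.prod_insert hj, Finset.prod_insert hj, Finset.sum_insert hj]
    have e : a j * ∏ i ∈ s, a i - b j * ∏ i ∈ s, b i =
        (a j - b j) * ∏ i ∈ s, a i + b j * (∏ i ∈ s, a i - ∏ i ∈ s, b i) := by ring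
    have h0 : 0 ≤ ∏ i ∈ s, a i := Finset.prod_nonneg fun i _ => (ha i).1
    have h1 : ∏ i ∈ s, a i ≤ 1 := Finset.prod_le_one (fun i _ => (ha i).1) fun i _ => (ha i).2
    rw [e]
    refine (abs_add_le _ _).trans (add_le_add ?_ ?_)
    · rw [abs_mul, abs_of_nonneg h0]
      exact mul_le_of_le_one_right (abs_nonneg _) h1
    · rw [abs_mul, abs_of_nonneg (hb j).1]
      exact (mul_le_of_le_one_left (abs_nonneg _) (hb j).2).trans ih

/-- The Bernstein coefficient of degree `d` in every variable, at the multi-index `ν`, of a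
polynomial in several variables. -/
noncomputable def multiBernsteinCoeff {m : ℕ} (P : MvPolynomial (Fin m) ℝ) (d : ℕ)
    (ν : Fin m → Fin (d + 1)) : ℝ :=
  ∑ κ ∈ P.support, P.coeff κ * ∏ j, bernsteinCoeff d (ν j) (κ j)

/-- The Bernstein coefficients approach the values of the polynomial at the grid points
`ν / d`. -/
lemma exists_abs_multiBernsteinCoeff_sub_eval_le {m : ℕ} (P : MvPolynomial (Fin m) ℝ) :
    ∃ M : ℝ, ∀ d : ℕ, P.totalDegree < d → ∀ ν : Fin m → Fin (d + 1),
      |multiBernsteinCoeff P d ν - MvPolynomial.eval (fun j => ((ν j : ℕ) : ℝ) / d) P| ≤ M / d := by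
  refine ⟨∑ κ ∈ P.support, |P.coeff κ| * ∑ j, (κ j : ℝ) ^ 2, fun d hd ν => ?_⟩
  have hd0 : (0 : ℝ) < d := by exact_mod_cast (Nat.zero_le _).trans_lt hd
  have hν (j : Fin m) : (ν j : ℕ) ≤ d := Nat.lt_succ_iff.1 (ν j).2
  rw [multiBernsteinCoeff, MvPolynomial.eval_eq', ← Finset.sum_sub_distrib, Finset.sum_div]
  refine (Finset.abs_sum_le_sum_abs _ _).trans (Finset.sum_le_sum fun κ hκ => ?_)
  rw [← mul_sub, abs_mul, mul_div_assoc, Finset.sum_div]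
  refine mul_le_mul_of_nonneg_left ?_ (abs_nonneg _)
  refine (abs_prod_sub_prod_le_sum _ _ _
    (fun j => ⟨bernsteinCoeff_nonneg _ _ _, bernsteinCoeff_le_one (hν j) _⟩)
    fun j => ⟨by positivity, pow_le_one₀ (by positivity)
      ((div_le_one hd0).2 (by exact_mod_cast hν j))⟩).trans ?_
  refine Finset.sum_le_sum fun j _ => abs_bernsteinCoeff_sub_pow_le (hν j) ?_
  have h1 : κ j ≤ κ.degree := Finsupp.le_degree j κ
  have h2 := MvPolynomial.le_totalDegree hκ
  exact h1.trans (h2.trans hd.le)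

lemma aeval_eq_sum_multiBernsteinCoeff {m : ℕ} {A : Type*} [CommRing A] [Algebra ℝ A]
    (u : Fin m → A) (P : MvPolynomial (Fin m) ℝ) {d : ℕ} (hd : P.totalDegree ≤ d) :
    MvPolynomial.aeval u P = ∑ ν : Fin m → Fin (d + 1),
      algebraMap ℝ A (multiBernsteinCoeff P d ν) *
        ∏ j, (d.choose (ν j) * (u j ^ (ν j : ℕ) * (1 - u j) ^ (d - ν j))) := by
  have h1 (κ : Fin m →₀ ℕ) (hκ : κ ∈ P.support) : ∏ j, u j ^ κ j = ∑ ν : Fin m → Fin (d + 1),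
      algebraMap ℝ A (∏ j, bernsteinCoeff d (ν j) (κ j)) *
        ∏ j, (d.choose (ν j) * (u j ^ (ν j : ℕ) * (1 - u j) ^ (d - ν j))) := by
    have h2 (j : Fin m) : κ j ≤ d :=
      (Finsupp.le_degree j κ).trans ((MvPolynomial.le_totalDegree hκ).trans hd)
    rw [Finset.prod_congr rfl fun j _ =>
      pow_eq_sum_bernsteinCoeff (add_sub_cancel (u j) 1) (h2 j), Fintype.prod_sum]
    refine Finset.sum_congr rfl fun ν _ => ?_
    rw [Finset.prod_mul_distrib, map_prod]
  rw [MvPolynomial.aeval_def, MvPolynomial.eval₂_eq']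
  simp only [multiBernsteinCoeff, map_sum, map_mul, Finset.sum_mul]
  rw [Finset.sum_comm]
  refine Finset.sum_congr rfl fun κ hκ => ?_
  rw [h1 κ hκ, Finset.mul_sum]
  exact Finset.sum_congr rfl fun ν _ => by rw [mul_assoc]

/-- A polynomial that is positive on the unit cube has nonnegative Bernstein coefficients of some
degree. Hence it is a polynomial with nonnegative coefficients in the `2m` functions `uⱼ` and
`1 - uⱼ`, and lies in each semiring that contains these. -/
theorem aeval_mem_of_pos_on_unitCube {m : ℕ} {A : Type*} [CommRing A] [Algebra ℝ A]
    (T : Subsemiring A) (hT : ∀ c : ℝ, 0 ≤ c → algebraMap ℝ A c ∈ T) (u : Fin m → A)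
    (hu : ∀ j, u j ∈ T) (hu' : ∀ j, 1 - u j ∈ T) (P : MvPolynomial (Fin m) ℝ)
    (hP : ∀ x ∈ Set.Icc (0 : Fin m → ℝ) 1, 0 < MvPolynomial.eval x P) :
    MvPolynomial.aeval u P ∈ T := by
  obtain ⟨δ, hδ, hδP⟩ : ∃ δ > 0, ∀ x ∈ Set.Icc (0 : Fin m → ℝ) 1, δ ≤ MvPolynomial.eval x P := by
    obtain ⟨x₀, hx₀, hmin⟩ := (isCompact_Icc (a := (0 : Fin m → ℝ)) (b := 1)).exists_isMinOn
      (Set.nonempty_Icc.2 zero_le_one) (MvPolynomial.continuous_eval P).continuousOn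
    exact ⟨_, hP x₀ hx₀, fun x hx => hmin hx⟩
  obtain ⟨M, hM⟩ := exists_abs_multiBernsteinCoeff_sub_eval_le P
  obtain ⟨n, hn⟩ := exists_nat_gt (M / δ)
  have hd : P.totalDegree < max (P.totalDegree + 1) n := by simp
  set d := max (P.totalDegree + 1) n
  have hd0 : (0 : ℝ) < d := by exact_mod_cast (Nat.zero_le _).trans_lt hd
  have hMd : M / d < δ := by
    rw [div_lt_iff₀ hδ] at hn
    rw [div_lt_iff₀ hd0]
    have : (n : ℝ) ≤ d := by exact_mod_cast le_max_right _ _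
    nlinarith
  rw [aeval_eq_sum_multiBernsteinCoeff u P hd.le]
  refine sum_mem fun ν _ => mul_mem (hT _ ?_) (prod_mem fun j _ => mul_mem (natCast_mem _ _)
    (mul_mem (pow_mem (hu j) _) (pow_mem (hu' j) _)))
  have h1 := hδP (fun j => ((ν j : ℕ) : ℝ) / d) ⟨fun j => by simp; positivity, fun j =>
    (div_le_one hd0).2 (by exact_mod_cast Nat.lt_succ_iff.1 (ν j).2)⟩
  have h2 := (abs_le.1 (hM d hd ν)).1
  linarith

end WassersteinSOS

namespace WassersteinSOS

/-! ### Quadratic modules and Putinar's Positivstellensatz -/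

variable {m L : ℕ}

lemma isSumSq_pow_two {R : Type*} [CommRing R] (a : R) : IsSumSq (a ^ 2) := by
  rw [pow_two]; exact IsSumSq.mul_self a

lemma isSumSq_C {c : ℝ} (hc : 0 ≤ c) : IsSumSq (MvPolynomial.C c : MvPolynomial (Fin m) ℝ) := by
  rw [← Real.mul_self_sqrt hc, MvPolynomial.C_mul]
  exact IsSumSq.mul_self _

lemma eval_nonneg_of_isSumSq {p : MvPolynomial (Fin m) ℝ} (hp : IsSumSq p) (x : Fin m → ℝ) :
    0 ≤ MvPolynomial.eval x p := by
  induction hp with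
  | zero => simp
  | sq_add a _ ih =>
    rw [map_add, map_mul]
    exact add_nonneg (mul_self_nonneg _) ih

lemma quadraticModule_add {h : Fin L → MvPolynomial (Fin m) ℝ} {p q : MvPolynomial (Fin m) ℝ}
    (hp : p ∈ quadraticModule h) (hq : q ∈ quadraticModule h) : p + q ∈ quadraticModule h := by
  obtain ⟨s, σ, hs, hσ, rfl⟩ := hp
  obtain ⟨t, τ, ht, hτ, rfl⟩ := hq
  refine ⟨s + t, fun l => σ l + τ l, hs.add ht, fun l => (hσ l).add (hτ l), ?_⟩
  simp only [add_mul, Finset.sum_add_distrib]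
  ring

lemma quadraticModule_mul {h : Fin L → MvPolynomial (Fin m) ℝ} {p q : MvPolynomial (Fin m) ℝ}
    (hp : IsSumSq p) (hq : q ∈ quadraticModule h) : p * q ∈ quadraticModule h := by
  obtain ⟨t, τ, ht, hτ, rfl⟩ := hq
  refine ⟨p * t, fun l => p * τ l, hp.mul ht, fun l => hp.mul (hτ l), ?_⟩
  rw [mul_add, Finset.mul_sum]
  simp only [mul_assoc]

lemma mem_quadraticModule_of_isSumSq (h : Fin L → MvPolynomial (Fin m) ℝ)
    {p : MvPolynomial (Fin m) ℝ} (hp : IsSumSq p) : p ∈ quadraticModule h :=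
  ⟨p, fun _ => 0, hp, fun _ => .zero, by simp⟩

lemma sum_mul_mem_quadraticModule {h σ : Fin L → MvPolynomial (Fin m) ℝ}
    (hσ : ∀ l, IsSumSq (σ l)) : ∑ l, σ l * h l ∈ quadraticModule h :=
  ⟨0, σ, .zero, hσ, by simp⟩

/-- The set `{σ₀ + σ₁ n : σ₀, σ₁ sums of squares}`. A quadratic module with a single generator is
closed under multiplication because `n * n` is a square. -/
def singlePreorder {R : Type*} [CommRing R] (n : R) : Subsemiring R where
  carrier := {f | ∃ s t : R, IsSumSq s ∧ IsSumSq t ∧ f = s + t * n}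
  zero_mem' := ⟨0, 0, .zero, .zero, by simp⟩
  one_mem' := ⟨1, 0, IsSumSq.one, .zero, by simp⟩
  add_mem' := by
    rintro _ _ ⟨s, t, hs, ht, rfl⟩ ⟨s', t', hs', ht', rfl⟩
    exact ⟨s + s', t + t', hs.add hs', ht.add ht', by ring⟩
  mul_mem' := by
    rintro _ _ ⟨s, t, hs, ht, rfl⟩ ⟨s', t', hs', ht', rfl⟩
    exact ⟨s * s' + t * t' * (n * n), s * t' + t * s',
      (hs.mul hs').add ((ht.mul ht').mul (IsSumSq.mul_self n)),
      (hs.mul ht').add (ht.mul hs'), by ring⟩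

lemma mem_singlePreorder_of_isSumSq {R : Type*} [CommRing R] (n : R) {p : R} (hp : IsSumSq p) :
    p ∈ singlePreorder n := ⟨p, 0, hp, .zero, by simp⟩

lemma self_mem_singlePreorder {R : Type*} [CommRing R] (n : R) : n ∈ singlePreorder n :=
  ⟨0, 1, .zero, IsSumSq.one, by simp⟩

/-- The polynomial `a² - ‖x‖²`. -/
noncomputable def ballPoly (m : ℕ) (a : ℝ) : MvPolynomial (Fin m) ℝ :=
  MvPolynomial.C (a ^ 2) - ∑ j, MvPolynomial.X j ^ 2

/-- For `b = ±1`, the function `a + b xⱼ` lies in the preordering of the ball: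
`2a (a + b xⱼ) = (a + b xⱼ)² + (a² - ‖x‖²) + ∑_{i ≠ j} xᵢ²`. -/
lemma C_mul_add_mul_X_mem_singlePreorder {a : ℝ} (ha : 0 < a) {b : ℝ} (hb : b ^ 2 = 1)
    (j : Fin m) :
    MvPolynomial.C (1 / (2 * a)) * (MvPolynomial.C a + MvPolynomial.C b * MvPolynomial.X j) ∈
      singlePreorder (ballPoly m a) := by
  have e : (MvPolynomial.C (1 / (2 * a)) *
      (MvPolynomial.C a + MvPolynomial.C b * MvPolynomial.X j) : MvPolynomial (Fin m) ℝ) =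
      MvPolynomial.C ((1 / (2 * a)) ^ 2) *
        ((MvPolynomial.C a + MvPolynomial.C b * MvPolynomial.X j) ^ 2 + (ballPoly m a +
          ∑ i ∈ Finset.univ.erase j, MvPolynomial.X i ^ 2)) := by
    have e1 : (MvPolynomial.C (1 / (2 * a)) : MvPolynomial (Fin m) ℝ) =
        MvPolynomial.C ((1 / (2 * a)) ^ 2) * (2 * MvPolynomial.C a) := by
      rw [show (2 : MvPolynomial (Fin m) ℝ) = MvPolynomial.C 2 from rfl, ← MvPolynomial.C_mul,
        ← MvPolynomial.C_mul]
      congr 1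
      field_simp
    have e2 : (MvPolynomial.C b ^ 2 : MvPolynomial (Fin m) ℝ) = 1 := by
      rw [← MvPolynomial.C_pow, hb, MvPolynomial.C_1]
    rw [e1, ballPoly, ← Finset.add_sum_erase _ _ (Finset.mem_univ j), MvPolynomial.C_pow,
      MvPolynomial.C_pow]
    linear_combination
      (-MvPolynomial.C (1 / (2 * a)) ^ 2 * MvPolynomial.X j ^ 2 : MvPolynomial (Fin m) ℝ) * e2
  rw [e]
  exact mul_mem (mem_singlePreorder_of_isSumSq _ (isSumSq_C (sq_nonneg _)))
    (add_mem (mem_singlePreorder_of_isSumSq _ (isSumSq_pow_two _))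
      (add_mem (self_mem_singlePreorder _)
        (mem_singlePreorder_of_isSumSq _ (IsSumSq.sum fun i _ => isSumSq_pow_two _))))

/-- A polynomial that is positive on the cube `[-a, a]ᵐ` around the ball of radius `a` has a
representation `σ₀ + σ₁ (a² - ‖x‖²)`. -/
lemma mem_singlePreorder_of_pos_on_cube {a : ℝ} (ha : 0 < a) (p : MvPolynomial (Fin m) ℝ)
    (hp : ∀ x : Fin m → ℝ, (∀ j, |x j| ≤ a) → 0 < MvPolynomial.eval x p) :
    p ∈ singlePreorder (ballPoly m a) := by
  let u : Fin m → MvPolynomial (Fin m) ℝ := fun j =>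
    MvPolynomial.C (1 / (2 * a)) * (MvPolynomial.C a + MvPolynomial.C 1 * MvPolynomial.X j)
  let w : Fin m → MvPolynomial (Fin m) ℝ := fun j =>
    MvPolynomial.C (2 * a) * MvPolynomial.X j - MvPolynomial.C a
  have hc : (2 * MvPolynomial.C a * MvPolynomial.C (1 / (2 * a)) : MvPolynomial (Fin m) ℝ) = 1 := by
    rw [show (2 : MvPolynomial (Fin m) ℝ) = MvPolynomial.C 2 from rfl, ← MvPolynomial.C_mul,
      ← MvPolynomial.C_mul, mul_one_div_cancel (by positivity), MvPolynomial.C_1]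
  have huw : MvPolynomial.aeval u (MvPolynomial.aeval w p) = p := by
    rw [← AlgHom.comp_apply, MvPolynomial.comp_aeval]
    have : (fun j => MvPolynomial.aeval u (w j)) = MvPolynomial.X := by
      funext j
      simp only [w, u, map_sub, map_mul, MvPolynomial.aeval_X, MvPolynomial.algHom_C,
        MvPolynomial.algebraMap_eq, MvPolynomial.C_1, one_mul, map_ofNat]
      linear_combination (MvPolynomial.C a + MvPolynomial.X j : MvPolynomial (Fin m) ℝ) * hc
    rw [this, MvPolynomial.aeval_X_left_apply]
  rw [← huw]
  refine aeval_mem_of_pos_on_unitCube _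
    (fun c hc => mem_singlePreorder_of_isSumSq _ (isSumSq_C hc)) u
    (fun j => C_mul_add_mul_X_mem_singlePreorder ha (by norm_num) j) (fun j => ?_) _
    fun x hx => ?_
  · have e : 1 - u j = MvPolynomial.C (1 / (2 * a)) *
        (MvPolynomial.C a + MvPolynomial.C (-1) * MvPolynomial.X j) := by
      simp only [u, MvPolynomial.C_neg, MvPolynomial.C_1]
      linear_combination -hc
    rw [e]
    exact C_mul_add_mul_X_mem_singlePreorder ha (by norm_num) j
  · have e : MvPolynomial.eval x (MvPolynomial.aeval w p) =
        MvPolynomial.eval (fun j => 2 * a * x j - a) p := by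
      rw [← MvPolynomial.coe_aeval_eq_eval, ← MvPolynomial.coe_aeval_eq_eval, RingHom.coe_coe,
        RingHom.coe_coe, ← AlgHom.comp_apply, MvPolynomial.comp_aeval]
      simp [w]
    rw [e]
    refine hp _ fun j => abs_le.2 ?_
    have h0 : 0 ≤ x j := hx.1 j
    have h1 : x j ≤ 1 := hx.2 j
    constructor <;> nlinarith

/-- With `c⁻ = max (-c) 0`, the number `-(1 - c)ⁿ c` is at least `n (c⁻)² - 1 / n`. -/
lemma mul_sq_negPart_sub_le {c : ℝ} (hc : c ≤ 1) {n : ℕ} (hn : 0 < n) :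
    n * (max (-c) 0) ^ 2 - 1 / n ≤ -((1 - c) ^ n * c) := by
  have hn' : (0 : ℝ) < n := by exact_mod_cast hn
  rcases le_total 0 c with h | h
  · rw [max_eq_right (by linarith)]
    have h1 : 1 + n * c ≤ (1 + c) ^ n := one_add_mul_le_pow (by linarith) n
    have h2 : (1 - c) ^ n * (1 + c) ^ n ≤ 1 := by
      rw [← mul_pow]
      exact pow_le_one₀ (mul_nonneg (by linarith) (by linarith)) (by nlinarith)
    have h3 : 0 ≤ (1 - c) ^ n := pow_nonneg (by linarith) n
    have h4 := mul_le_mul_of_nonneg_left h1 h3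
    have h5 : (1 - c) ^ n * c ≤ 1 / n := by
      rw [le_div_iff₀ hn']
      nlinarith
    linarith
  · rw [max_eq_left (by linarith)]
    have h1 : 1 + n * (-c) ≤ (1 + -c) ^ n := one_add_mul_le_pow (by linarith) n
    rw [← sub_eq_add_neg] at h1
    have h2 := mul_le_mul_of_nonneg_right h1 (neg_nonneg.2 h)
    have h3 : 0 ≤ 1 / (n : ℝ) := by positivity
    nlinarith

/-- If `f > 0` wherever all `bₗ ≥ 0` on a compact set on which `bₗ ≤ 1`, then
`f - ∑ (1 - bₗ)ⁿ bₗ` is positive on this set for all large `n`: the penalty is at most `1 / n`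
where `bₗ ≥ 0`, and very negative where `bₗ < 0`. -/
lemma exists_pos_sub_sum_penalty {X : Type*} [TopologicalSpace X] {B : Set X} (hB : IsCompact B)
    {f : X → ℝ} (hf : Continuous f) {b : Fin L → X → ℝ} (hb : ∀ l, Continuous (b l))
    (hb1 : ∀ l, ∀ x ∈ B, b l x ≤ 1) (hpos : ∀ x ∈ B, (∀ l, 0 ≤ b l x) → 0 < f x) :
    ∃ n₀ : ℕ, ∀ n ≥ n₀, ∀ x ∈ B, 0 < f x - ∑ l, (1 - b l x) ^ n * b l x := by
  rcases B.eq_empty_or_nonempty with rfl | hne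
  · exact ⟨0, by simp⟩
  let e : X → ℝ := fun x => ∑ l, (max (-b l x) 0) ^ 2
  have he : Continuous e := by fun_prop
  have he0 (x : X) : 0 ≤ e x := Finset.sum_nonneg fun l _ => sq_nonneg _
  obtain ⟨x₁, hx₁, hmin₁⟩ := hB.exists_isMinOn hne (hf.max he).continuousOn
  obtain ⟨x₂, hx₂, hmin₂⟩ := hB.exists_isMinOn hne hf.continuousOn
  have hη : 0 < max (f x₁) (e x₁) := by
    rcases (he0 x₁).eq_or_lt with h | h
    · refine lt_max_of_lt_left (hpos x₁ hx₁ fun l => ?_)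
      have := (Finset.sum_eq_zero_iff_of_nonneg fun l _ => sq_nonneg _).1 h.symm l
        (Finset.mem_univ l)
      rw [sq_eq_zero_iff] at this
      linarith [le_max_left (-b l x₁) 0]
    · exact lt_max_of_lt_right h
  set η := max (f x₁) (e x₁)
  obtain ⟨n₁, hn₁⟩ := exists_nat_gt (L / η)
  obtain ⟨n₂, hn₂⟩ := exists_nat_gt ((L - f x₂) / η)
  refine ⟨max (max n₁ n₂) 1, fun n hn x hx => ?_⟩
  have hn1 : 1 ≤ n := (le_max_right _ _).trans hn
  have hn1' : (1 : ℝ) ≤ n := by exact_mod_cast hn1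
  have hnn₁ : (n₁ : ℝ) ≤ n := by
    exact_mod_cast ((le_max_left _ _).trans (le_max_left _ _)).trans hn
  have hnn₂ : (n₂ : ℝ) ≤ n := by
    exact_mod_cast ((le_max_right _ _).trans (le_max_left _ _)).trans hn
  have key : n * e x - L / n ≤ -∑ l, (1 - b l x) ^ n * b l x := by
    rw [← Finset.sum_neg_distrib]
    refine le_trans (le_of_eq ?_)
      (Finset.sum_le_sum fun l _ => mul_sq_negPart_sub_le (hb1 l x hx) hn1)
    rw [Finset.sum_sub_distrib, ← Finset.mul_sum]
    simp [e, div_eq_mul_inv]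
  have hL : (0 : ℝ) ≤ L := by positivity
  have hor : η ≤ max (f x) (e x) := hmin₁ hx
  rw [div_lt_iff₀ hη] at hn₁ hn₂
  rcases le_max_iff.1 hor with h | h
  · have h1 : L / (n : ℝ) < η := by
      rw [div_lt_iff₀ (by linarith)]
      nlinarith
    have h2 : 0 ≤ n * e x := mul_nonneg (by linarith) (he0 x)
    linarith
  · have h1 : f x₂ ≤ f x := hmin₂ hx
    have h2 : L / (n : ℝ) ≤ L := div_le_self hL hn1'
    have h3 : (n : ℝ) * η ≤ n * e x := by gcongr
    have h4 : (n₂ : ℝ) * η ≤ n * η := by gcongr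
    linarith

/-- **Putinar's Positivstellensatz**: under the Archimedean condition, a polynomial that is
positive on `{h ≥ 0}` lies in the quadratic module of `h`. -/
theorem mem_quadraticModule_of_pos {h : Fin L → MvPolynomial (Fin m) ℝ}
    (hArch : ArchimedeanCondition h) (f : MvPolynomial (Fin m) ℝ)
    (hf : ∀ x : Fin m → ℝ, (∀ l, 0 ≤ MvPolynomial.eval x (h l)) → 0 < MvPolynomial.eval x f) :
    f ∈ quadraticModule h := by
  obtain ⟨R, hR⟩ := hArch
  set a : ℝ := R + 1 with ha_def
  have ha : 0 < a := by positivity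
  have hball : ballPoly m a ∈ quadraticModule h := by
    have e : ballPoly m a = (MvPolynomial.C (R : ℝ) - ∑ j, MvPolynomial.X j ^ 2) +
        MvPolynomial.C (a ^ 2 - R) := by
      rw [ballPoly, MvPolynomial.C_sub]; ring
    rw [e]
    have hR0 : (0 : ℝ) ≤ R := by positivity
    exact quadraticModule_add hR
      (mem_quadraticModule_of_isSumSq h (isSumSq_C (by rw [ha_def]; nlinarith)))
  have hsub {p : MvPolynomial (Fin m) ℝ} (hp : p ∈ singlePreorder (ballPoly m a)) :
      p ∈ quadraticModule h := by
    obtain ⟨s, t, hs, ht, rfl⟩ := hp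
    exact quadraticModule_add (mem_quadraticModule_of_isSumSq h hs) (quadraticModule_mul ht hball)
  have hB : IsCompact (Set.Icc (fun _ => -a : Fin m → ℝ) fun _ => a) := isCompact_Icc
  -- a common factor `c > 0` with `c * h l ≤ 1` on the cube
  obtain ⟨c, hc, hc1⟩ : ∃ c > 0, ∀ l, ∀ x ∈ Set.Icc (fun _ => -a : Fin m → ℝ) fun _ => a,
      c * MvPolynomial.eval x (h l) ≤ 1 := by
    have hbd (l : Fin L) := hB.bddAbove_image (MvPolynomial.continuous_eval (h l)).continuousOn
    choose M hM using hbd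
    have hS : 0 < 1 + ∑ l, |M l| := by positivity
    refine ⟨(1 + ∑ l, |M l|)⁻¹, inv_pos.2 hS, fun l x hx => ?_⟩
    rw [inv_mul_le_iff₀ hS, mul_one]
    have h1 : MvPolynomial.eval x (h l) ≤ M l := hM l ⟨x, hx, rfl⟩
    have h2 := Finset.single_le_sum (fun i _ => abs_nonneg (M i)) (Finset.mem_univ l)
    linarith [le_abs_self (M l)]
  obtain ⟨n, hn⟩ := exists_pos_sub_sum_penalty hB (f := fun x => MvPolynomial.eval x f)
    (MvPolynomial.continuous_eval f) (b := fun l x => c * MvPolynomial.eval x (h l))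
    (fun l => continuous_const.mul (MvPolynomial.continuous_eval (h l))) hc1
    (fun x _ hx => hf x fun l => nonneg_of_mul_nonneg_right (hx l) hc)
  let σ : Fin L → MvPolynomial (Fin m) ℝ := fun l =>
    ((1 - MvPolynomial.C c * h l) ^ n) ^ 2 * MvPolynomial.C c
  have hσ (l : Fin L) : IsSumSq (σ l) := (isSumSq_pow_two _).mul (isSumSq_C hc.le)
  rw [← sub_add_cancel f (∑ l, σ l * h l)]
  refine quadraticModule_add (hsub (mem_singlePreorder_of_pos_on_cube ha _ fun x hx => ?_))
    (sum_mul_mem_quadraticModule hσ)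
  have h1 := hn (n * 2) (by omega) x ⟨fun j => (abs_le.1 (hx j)).1, fun j => (abs_le.1 (hx j)).2⟩
  simpa [σ, ← pow_mul, mul_assoc] using h1

end WassersteinSOS

namespace WassersteinSOS

/-! ### Lagrangian duality for the Wasserstein ball -/

/-- Lagrange multiplier for a convex program with one constraint, in terms of the convex set `D` of
pairs (constraint value, objective value). The point `(0, y₀)`, with `0 < b`, is the Slater point
that excludes a vertical separating line. -/
lemma exists_lagrangeMultiplier {D : Set (ℝ × ℝ)} (hD : Convex ℝ D) {b v y₀ : ℝ} (hb : 0 < b)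
    (h0 : (0, y₀) ∈ D) (hv : ∀ z ∈ D, z.1 ≤ b → v ≤ z.2) :
    ∃ lam : ℝ, 0 ≤ lam ∧ ∀ z ∈ D, v ≤ z.2 + lam * (z.1 - b) := by
  obtain ⟨φ, u, hU, hDu⟩ := geometric_hahn_banach_open
    (s := Set.Iio b ×ˢ Set.Iio v) (t := D) ((convex_Iio b).prod (convex_Iio v))
    (isOpen_Iio.prod isOpen_Iio) hD (Set.disjoint_left.2 fun z hz hzD =>
      absurd (hv z hzD hz.1.le) (not_le.2 hz.2))
  obtain ⟨p, hp⟩ : ∃ p, p = φ (1, 0) := ⟨_, rfl⟩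
  obtain ⟨q, hq⟩ : ∃ q, q = φ (0, 1) := ⟨_, rfl⟩
  have hφ (x y : ℝ) : φ (x, y) = p * x + q * y := by
    have : ((x, y) : ℝ × ℝ) = x • (1, 0) + y • (0, 1) := by simp
    rw [this, map_add, map_smul, map_smul, hp, hq, smul_eq_mul, smul_eq_mul, mul_comm x, mul_comm y]
  have hU' (x y : ℝ) (hx : x < b) (hy : y < v) : p * x + q * y < u := hφ x y ▸ hU (x, y) ⟨hx, hy⟩
  have hp0 : 0 ≤ p := by
    by_contra! hneg
    have h1 := hU' (min (b - 1) ((u - q * (v - 1)) / p)) (v - 1)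
      ((min_le_left _ _).trans_lt (by linarith)) (by linarith)
    have h2 := mul_le_mul_of_nonpos_left
      (min_le_right (b - 1) ((u - q * (v - 1)) / p)) hneg.le
    rw [mul_div_cancel₀ _ hneg.ne] at h2
    linarith
  have hq0 : 0 ≤ q := by
    by_contra! hneg
    have h1 := hU' (b - 1) (min (v - 1) ((u - p * (b - 1)) / q))
      (by linarith) ((min_le_left _ _).trans_lt (by linarith))
    have h2 := mul_le_mul_of_nonpos_left
      (min_le_right (v - 1) ((u - p * (b - 1)) / q)) hneg.le
    rw [mul_div_cancel₀ _ hneg.ne] at h2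
    linarith
  have hcorner : p * b + q * v ≤ u := by
    by_contra! hlt
    have hpq : 0 < p + q + 1 := by linarith
    have hδ : 0 < (p * b + q * v - u) / (p + q + 1) := div_pos (by linarith) hpq
    have h1 := hU' (b - (p * b + q * v - u) / (p + q + 1))
      (v - (p * b + q * v - u) / (p + q + 1)) (by linarith) (by linarith)
    have h2 : (p * b + q * v - u) / (p + q + 1) * (p + q + 1) = p * b + q * v - u :=
      div_mul_cancel₀ _ hpq.ne'
    linarith
  have h00 : u ≤ q * y₀ := by simpa [hφ] using hDu _ h0
  have hqpos : 0 < q := by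
    refine hq0.lt_of_ne fun hq' => ?_
    rw [← hq'] at h00 hcorner hU'
    have h1 := hU' (b - 1) (v - 1) (by linarith) (by linarith)
    have h2 : p ≤ 0 := nonpos_of_mul_nonpos_left (by linarith) hb
    rw [le_antisymm h2 hp0] at h1 hcorner
    linarith
  refine ⟨p / q, div_nonneg hp0 hq0, fun z hz => ?_⟩
  have h1 : u ≤ p * z.1 + q * z.2 := hφ z.1 z.2 ▸ hDu z hz
  have h2 : q * (v - (z.2 + p / q * (z.1 - b))) ≤ 0 := by
    have : q * (v - (z.2 + p / q * (z.1 - b))) = q * v - q * z.2 - p * (z.1 - b) := by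
      field_simp
      ring
    linarith
  have h3 := nonpos_of_mul_nonpos_right h2 hqpos
  linarith

variable {m N : ℕ}

/-- The transport cost `‖ξ - ξ'‖²` on `Ξ × Ξ`. -/
noncomputable def transportCost {S : Set (EuclideanSpace ℝ (Fin m))} (z : S × S) : ℝ :=
  ‖(z.1 : EuclideanSpace ℝ (Fin m)) - z.2‖ ^ 2

lemma transportCost_nonneg {S : Set (EuclideanSpace ℝ (Fin m))} (z : S × S) :
    0 ≤ transportCost z := sq_nonneg _

lemma continuous_transportCost {S : Set (EuclideanSpace ℝ (Fin m))} :
    Continuous (transportCost (S := S)) := by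
  unfold transportCost; fun_prop

lemma integrable_of_continuous {X : Type*} [TopologicalSpace X] [CompactSpace X]
    [MeasurableSpace X] [OpensMeasurableSpace X] {f : X → ℝ} (hf : Continuous f) (μ : Measure X)
    [IsFiniteMeasure μ] : Integrable f μ :=
  hf.integrable_of_hasCompactSupport (HasCompactSupport.of_compactSpace f)

lemma isProbabilityMeasure_average {X : Type*} [MeasurableSpace X] (hN : 0 < N) (x : Fin N → X) :
    IsProbabilityMeasure ((N : ℝ≥0∞)⁻¹ • ∑ i, Measure.dirac (x i)) := by
  constructor
  simp [ENNReal.inv_mul_cancel (by exact_mod_cast hN.ne' : (N : ℝ≥0∞) ≠ 0)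
    (ENNReal.natCast_ne_top N)]

lemma integral_average {X : Type*} [MeasurableSpace X] [MeasurableSingletonClass X]
    (x : Fin N → X) (f : X → ℝ) :
    ∫ y, f y ∂((N : ℝ≥0∞)⁻¹ • ∑ i, Measure.dirac (x i)) = 1 / (N : ℝ) * ∑ i, f (x i) := by
  rw [integral_smul_measure, integral_finsetSum_measure fun i _ => integrable_dirac (by simp)]
  simp [integral_dirac]

lemma map_average {X Y : Type*} [MeasurableSpace X] [MeasurableSpace Y] {φ : X → Y}
    (hφ : Measurable φ) (x : Fin N → X) :
    ((N : ℝ≥0∞)⁻¹ • ∑ i, Measure.dirac (x i)).map φ =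
      (N : ℝ≥0∞)⁻¹ • ∑ i, Measure.dirac (φ (x i)) := by
  rw [Measure.map_smul, Measure.map_finset_sum hφ.aemeasurable]
  simp only [Measure.map_dirac' hφ]

section

variable {S : Set (EuclideanSpace ℝ (Fin m))} [CompactSpace S]

lemma lintegral_transportCost (γ : Measure (S × S)) [IsFiniteMeasure γ] :
    (∫⁻ z, ENNReal.ofReal (‖(z.1 : EuclideanSpace ℝ (Fin m)) - z.2‖ ^ 2) ∂γ) ^ (1 / 2 : ℝ) =
      ENNReal.ofReal √(∫ z, transportCost z ∂γ) := by
  have h := ofReal_integral_eq_lintegral_ofReal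
    (integrable_of_continuous (continuous_transportCost (S := S)) γ)
    (ae_of_all _ transportCost_nonneg)
  unfold transportCost at h ⊢
  rw [← h, ENNReal.ofReal_rpow_of_nonneg (integral_nonneg fun z => sq_nonneg _) (by norm_num),
    Real.sqrt_eq_rpow]

/-- Weak duality: integrate `αᵢ ≤ f ξ + λ ‖ξ - ξ̂ᵢ‖²` against a nearly optimal coupling. -/
lemma neg_mul_add_average_le_integral (hN : 0 < N) {f : S → ℝ} (hf : Continuous f)
    (xhat : Fin N → S) {ε : ℝ} (hε : 0 < ε) {Q : ProbabilityMeasure S}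
    (hQ : Q ∈ wassersteinBall xhat ε) {lam : ℝ} (hlam : 0 ≤ lam) {α : Fin N → ℝ}
    (hα : ∀ i x, α i ≤ f x + lam * transportCost (x, xhat i)) :
    -lam * ε ^ 2 + 1 / (N : ℝ) * ∑ i, α i ≤ ∫ x, f x ∂(Q : Measure S) := by
  have : Nonempty S := ⟨xhat ⟨0, hN⟩⟩
  -- the `c`-transform of `f` replaces `α`, which need not be a function of the sample point
  let a : S → ℝ := fun y => sInf ((fun x => f x + lam * transportCost (x, y)) '' Set.univ)
  have hcont : Continuous fun z : S × S => f z.1 + lam * transportCost z :=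
    (hf.comp continuous_fst).add (continuous_const.mul continuous_transportCost)
  have ha : Continuous a := isCompact_univ.continuous_sInf
    (f := fun y x => f x + lam * transportCost (x, y)) (hcont.comp continuous_swap)
  have ha_le (x y : S) : a y ≤ f x + lam * transportCost (x, y) :=
    csInf_le (isCompact_univ.bddBelow_image
      (hcont.comp (continuous_id.prodMk continuous_const)).continuousOn) ⟨x, trivial, rfl⟩
  have hαa (i : Fin N) : α i ≤ a (xhat i) :=
    le_csInf (Set.univ_nonempty.image _) (by rintro _ ⟨x, -, rfl⟩; exact hα i x)
  have key (δ : ℝ) (hδ : 0 < δ) :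
      1 / (N : ℝ) * ∑ i, α i ≤ ∫ x, f x ∂(Q : Measure S) + lam * (ε + δ) ^ 2 := by
    have hlt : wassersteinDist (Q : Measure S) (empiricalMeasure xhat) <
        ENNReal.ofReal (ε + δ) :=
      lt_of_le_of_lt hQ ((ENNReal.ofReal_lt_ofReal_iff (by linarith)).2 (by linarith))
    unfold wassersteinDist at hlt
    simp only [iInf_lt_iff] at hlt
    obtain ⟨γ, ⟨hγ₁, hγ₂⟩, hγ⟩ := hlt
    have : IsProbabilityMeasure γ := by
      have : IsProbabilityMeasure (γ.map Prod.fst) := hγ₁ ▸ inferInstance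
      exact Measure.isProbabilityMeasure_of_map Prod.fst
    rw [lintegral_transportCost, ENNReal.ofReal_lt_ofReal_iff (by linarith),
      Real.sqrt_lt' (by linarith)] at hγ
    have h1 : ∫ x, f x ∂(Q : Measure S) = ∫ z, f z.1 ∂γ := by
      rw [← hγ₁, integral_map measurable_fst.aemeasurable hf.aestronglyMeasurable]
    have h2 : 1 / (N : ℝ) * ∑ i, a (xhat i) = ∫ z, a z.2 ∂γ := by
      rw [← integral_average xhat a, ← empiricalMeasure, ← hγ₂,
        integral_map measurable_snd.aemeasurable ha.aestronglyMeasurable]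
    have h3 : ∫ z, a z.2 ∂γ ≤ ∫ z, (f z.1 + lam * transportCost z) ∂γ :=
      integral_mono (integrable_of_continuous (ha.comp continuous_snd) γ)
        (integrable_of_continuous hcont γ) fun z => ha_le z.1 z.2
    rw [integral_add (f := fun z : S × S => f z.1) (g := fun z => lam * transportCost z)
      (integrable_of_continuous (hf.comp continuous_fst) γ)
      (integrable_of_continuous (continuous_const.mul continuous_transportCost) γ),
      integral_const_mul] at h3
    have h4 : 1 / (N : ℝ) * ∑ i, α i ≤ 1 / (N : ℝ) * ∑ i, a (xhat i) := by
      gcongr with i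
      exact hαa i
    have h5 := mul_le_mul_of_nonneg_left hγ.le hlam
    linarith
  have hlim : Tendsto (fun δ : ℝ => ∫ x, f x ∂(Q : Measure S) + lam * (ε + δ) ^ 2) (𝓝[>] 0)
      (𝓝 (∫ x, f x ∂(Q : Measure S) + lam * (ε + 0) ^ 2)) := by
    refine tendsto_nhdsWithin_of_tendsto_nhds (Continuous.tendsto ?_ 0)
    fun_prop
  have h := ge_of_tendsto hlim (eventually_mem_nhdsWithin.mono key)
  rw [add_zero] at h
  linarith

/-- Strong duality with attainment on both sides: an optimal coupling `γ`, and a multiplier `λ` for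
the bound on its transport cost. -/
lemma exists_coupling_and_multiplier (hN : 0 < N) {f : S → ℝ} (hf : Continuous f)
    (xhat : Fin N → S) {b : ℝ} (hb : 0 < b) :
    ∃ γ : ProbabilityMeasure (S × S),
      (γ : Measure (S × S)).map Prod.snd = empiricalMeasure xhat ∧
      ∫ z, transportCost z ∂(γ : Measure (S × S)) ≤ b ∧
      ∃ lam : ℝ, 0 ≤ lam ∧ ∀ x : Fin N → S, ∫ z, f z.1 ∂(γ : Measure (S × S)) ≤
        -lam * b + 1 / (N : ℝ) * ∑ i, (f (x i) + lam * transportCost (x i, xhat i)) := by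
  have hf1 : Continuous fun z : S × S => f z.1 := hf.comp continuous_fst
  have hcost : Continuous (transportCost (S := S)) := continuous_transportCost
  let P : ProbabilityMeasure S := ⟨empiricalMeasure xhat, isProbabilityMeasure_average hN xhat⟩
  -- the couplings of arbitrary laws with the empirical distribution
  let Γ : Set (ProbabilityMeasure (S × S)) :=
    {γ | (γ : Measure (S × S)).map Prod.snd = empiricalMeasure xhat}
  have hΓ : IsCompact Γ := by
    have hclosed : IsClosed ((fun γ : ProbabilityMeasure (S × S) =>
        γ.map (f := Prod.snd) measurable_snd.aemeasurable) ⁻¹' {P}) :=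
      isClosed_singleton.preimage (ProbabilityMeasure.continuous_map continuous_snd)
    have e : Γ = (fun γ : ProbabilityMeasure (S × S) =>
        γ.map (f := Prod.snd) measurable_snd.aemeasurable) ⁻¹' {P} := by
      ext γ
      exact (Subtype.ext_iff (a1 := γ.map (f := Prod.snd) measurable_snd.aemeasurable)
        (a2 := P)).symm
    exact e ▸ hclosed.isCompact
  have hint {φ : S × S → ℝ} (hφ : Continuous φ) :
      Continuous fun γ : ProbabilityMeasure (S × S) => ∫ z, φ z ∂(γ : Measure (S × S)) :=
    ProbabilityMeasure.continuous_integral_boundedContinuousFunction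
      (BoundedContinuousFunction.mkOfCompact ⟨φ, hφ⟩)
  let G : ProbabilityMeasure (S × S) → ℝ × ℝ := fun γ =>
    (∫ z, transportCost z ∂(γ : Measure (S × S)), ∫ z, f z.1 ∂(γ : Measure (S × S)))
  have hpoint (x : Fin N → S) : (1 / (N : ℝ) * ∑ i, transportCost (x i, xhat i),
      1 / (N : ℝ) * ∑ i, f (x i)) ∈ G '' Γ := by
    refine ⟨⟨_, isProbabilityMeasure_average hN fun i => (x i, xhat i)⟩, ?_, ?_⟩
    · exact map_average measurable_snd _
    · exact Prod.ext (integral_average _ _) (integral_average _ fun z : S × S => f z.1)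
  have hconv : Convex ℝ (G '' Γ) := by
    rintro _ ⟨γ, hγ, rfl⟩ _ ⟨γ', hγ', rfl⟩ s t hs ht hst
    have hprob : IsProbabilityMeasure (ENNReal.ofReal s • (γ : Measure (S × S)) +
        ENNReal.ofReal t • (γ' : Measure (S × S))) :=
      ⟨by simp [← ENNReal.ofReal_add hs ht, hst]⟩
    have hmix {φ : S × S → ℝ} (hφ : Continuous φ) :
        ∫ z, φ z ∂(ENNReal.ofReal s • (γ : Measure (S × S)) +
          ENNReal.ofReal t • (γ' : Measure (S × S))) =
        s * ∫ z, φ z ∂(γ : Measure (S × S)) + t * ∫ z, φ z ∂(γ' : Measure (S × S)) := by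
      rw [integral_add_measure
        ((integrable_of_continuous hφ _).smul_measure ENNReal.ofReal_ne_top)
        ((integrable_of_continuous hφ _).smul_measure ENNReal.ofReal_ne_top),
        integral_smul_measure, integral_smul_measure, ENNReal.toReal_ofReal hs,
        ENNReal.toReal_ofReal ht, smul_eq_mul, smul_eq_mul]
    refine ⟨⟨_, hprob⟩, ?_, Prod.ext (hmix hcost) (hmix hf1)⟩
    change Measure.map Prod.snd (ENNReal.ofReal s • (γ : Measure (S × S)) +
        ENNReal.ofReal t • (γ' : Measure (S × S))) = _
    rw [Measure.map_add _ _ measurable_snd, Measure.map_smul, Measure.map_smul,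
      show Measure.map Prod.snd (γ : Measure (S × S)) = _ from hγ,
      show Measure.map Prod.snd (γ' : Measure (S × S)) = _ from hγ', ← add_smul,
      ← ENNReal.ofReal_add hs ht, hst, ENNReal.ofReal_one, one_smul]
  have h0 : (0, 1 / (N : ℝ) * ∑ i, f (xhat i)) ∈ G '' Γ := by
    simpa [transportCost] using hpoint xhat
  obtain ⟨γ, ⟨hγΓ, hγb⟩, hmin⟩ : ∃ γ ∈ Γ ∩ {γ | (G γ).1 ≤ b},
      IsMinOn (fun γ => (G γ).2) (Γ ∩ {γ | (G γ).1 ≤ b}) γ := by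
    refine IsCompact.exists_isMinOn
      (hΓ.inter_right (isClosed_le (hint hcost) continuous_const)) ?_ (hint hf1).continuousOn
    obtain ⟨γ₀, hγ₀, e⟩ := h0
    exact ⟨γ₀, hγ₀, (congrArg Prod.fst e).trans_le hb.le⟩
  obtain ⟨lam, hlam, hdual⟩ := exists_lagrangeMultiplier hconv (v := (G γ).2) hb h0 (by
    rintro _ ⟨γ', hγ', rfl⟩ hle
    exact hmin ⟨hγ', hle⟩)
  refine ⟨γ, hγΓ, hγb, lam, hlam, fun x => (hdual _ (hpoint x)).trans (le_of_eq ?_)⟩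
  rw [Finset.sum_add_distrib, ← Finset.mul_sum]
  ring

end

end WassersteinSOS

namespace WassersteinSOS

/-! ### The sum-of-squares hierarchy -/

variable {m K L N : ℕ}

lemma isCompact_supportSet {h : Fin L → MvPolynomial (Fin m) ℝ} (hArch : ArchimedeanCondition h) :
    IsCompact (supportSet h) := by
  refine Metric.isCompact_of_isClosed_isBounded ?_ ?_
  · have e : supportSet h = ⋂ l, {ξ : EuclideanSpace ℝ (Fin m) |
        0 ≤ MvPolynomial.eval (fun j => ξ j) (h l)} := by
      ext ξ; simp [supportSet]
    rw [e]
    exact isClosed_iInter fun l => isClosed_le continuous_const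
      ((MvPolynomial.continuous_eval (h l)).comp (by fun_prop))
  · obtain ⟨R, σ₀, σ, hσ₀, hσ, e⟩ := hArch
    refine (Metric.isBounded_closedBall (x := 0) (r := √R)).subset fun ξ hξ => ?_
    rw [mem_closedBall_zero_iff, EuclideanSpace.norm_eq]
    refine Real.sqrt_le_sqrt ?_
    have h1 := congrArg (MvPolynomial.eval fun j => ξ j) e
    simp only [map_sub, map_add, map_sum, map_mul, map_pow, MvPolynomial.eval_C,
      MvPolynomial.eval_X] at h1
    have h2 : 0 ≤ ∑ l, MvPolynomial.eval (fun j => ξ j) (σ l) *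
        MvPolynomial.eval (fun j => ξ j) (h l) :=
      Finset.sum_nonneg fun l _ => mul_nonneg (eval_nonneg_of_isSumSq (hσ l) _) (hξ l)
    have h3 := eval_nonneg_of_isSumSq hσ₀ fun j => ξ j
    simp only [Real.norm_eq_abs, sq_abs]
    linarith

lemma continuous_minLoss (hK : 0 < K) (g : Fin K → MvPolynomial (Fin m) ℝ) :
    Continuous (minLoss g) := by
  have : Nonempty (Fin K) := ⟨⟨0, hK⟩⟩
  have h := Continuous.finset_inf' (s := Finset.univ) Finset.univ_nonempty
    (f := fun k (ξ : EuclideanSpace ℝ (Fin m)) => MvPolynomial.eval (fun j => ξ j) (g k))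
    fun k _ => (MvPolynomial.continuous_eval (g k)).comp (by fun_prop)
  refine h.congr fun ξ => ?_
  rw [Finset.inf'_apply, Finset.inf'_univ_eq_ciInf, minLoss]

lemma minLoss_le (g : Fin K → MvPolynomial (Fin m) ℝ) (ξ : EuclideanSpace ℝ (Fin m)) (k : Fin K) :
    minLoss g ξ ≤ MvPolynomial.eval (fun j => ξ j) (g k) :=
  ciInf_le (Set.finite_range _).bddBelow k

lemma eval_sqDistPoly (a ξ : EuclideanSpace ℝ (Fin m)) :
    MvPolynomial.eval (fun j => ξ j) (sqDistPoly a) = ‖ξ - a‖ ^ 2 := by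
  simp [sqDistPoly, EuclideanSpace.norm_sq_eq]

lemma IsFeasible.mono {h : Fin L → MvPolynomial (Fin m) ℝ} {g : Fin K → MvPolynomial (Fin m) ℝ}
    {ξhat : Fin N → supportSet h} {r s : ℕ} (hrs : r ≤ s) {lam : ℝ} {α : Fin N → ℝ}
    {σ : Fin K → Fin L → Fin N → MvPolynomial (Fin m) ℝ}
    (hF : IsFeasible h g ξhat r lam α σ) : IsFeasible h g ξhat s lam α σ :=
  ⟨hF.1, hF.2.1, fun k i => ⟨(hF.2.2.1 k i).1, (hF.2.2.1 k i).2.trans (by omega)⟩,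
    fun k l i => (hF.2.2.2 k l i).trans (by omega)⟩

lemma hierarchyValue_mono (h : Fin L → MvPolynomial (Fin m) ℝ)
    (g : Fin K → MvPolynomial (Fin m) ℝ) (ξhat : Fin N → supportSet h) (ε : ℝ) :
    Monotone (hierarchyValue h g ξhat ε) := fun _ _ hrs =>
  sSup_le_sSup fun _ ⟨lam, α, σ, hF, hv⟩ => ⟨lam, α, σ, hF.mono hrs, hv⟩

/-- A feasible point gives the constraint `αᵢ ≤ min_k g_k(ξ) + λ ‖ξ - ξ̂ᵢ‖²` of the Lagrangian
dual problem. -/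
lemma IsFeasible.le_minLoss_add (hK : 0 < K) {h : Fin L → MvPolynomial (Fin m) ℝ}
    {g : Fin K → MvPolynomial (Fin m) ℝ} {ξhat : Fin N → supportSet h} {r : ℕ} {lam : ℝ}
    {α : Fin N → ℝ} {σ : Fin K → Fin L → Fin N → MvPolynomial (Fin m) ℝ}
    (hF : IsFeasible h g ξhat r lam α σ) (i : Fin N) (ξ : supportSet h) :
    α i ≤ minLoss g ξ + lam * transportCost (ξ, ξhat i) := by
  have : Nonempty (Fin K) := ⟨⟨0, hK⟩⟩
  rw [← sub_le_iff_le_add]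
  refine le_ciInf fun k => ?_
  have h1 := eval_nonneg_of_isSumSq (hF.2.2.1 k i).1
    fun j => (ξ : EuclideanSpace ℝ (Fin m)) j
  simp only [map_sub, map_add, map_mul, map_sum, MvPolynomial.eval_C, eval_sqDistPoly] at h1
  have h2 : 0 ≤ ∑ l, MvPolynomial.eval (fun j => (ξ : EuclideanSpace ℝ (Fin m)) j) (σ k l i) *
      MvPolynomial.eval (fun j => (ξ : EuclideanSpace ℝ (Fin m)) j) (h l) :=
    Finset.sum_nonneg fun l _ => mul_nonneg (eval_nonneg_of_isSumSq (hF.2.1 k l i) _) (ξ.2 l)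
  simp only [transportCost]
  linarith

/-- By Putinar's Positivstellensatz, a point that satisfies the constraints of the Lagrangian dual
problem with strict inequality is feasible for some level of the hierarchy. -/
lemma exists_isFeasible_of_lt {h : Fin L → MvPolynomial (Fin m) ℝ} (hArch : ArchimedeanCondition h)
    (g : Fin K → MvPolynomial (Fin m) ℝ) (ξhat : Fin N → supportSet h) {lam : ℝ} (hlam : 0 ≤ lam)
    {α : Fin N → ℝ}
    (hα : ∀ i (ξ : supportSet h), α i < minLoss g ξ + lam * transportCost (ξ, ξhat i)) :
    ∃ r σ, IsFeasible h g ξhat r lam α σ := by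
  have hQ (k : Fin K) (i : Fin N) : g k + MvPolynomial.C lam *
      sqDistPoly (ξhat i : EuclideanSpace ℝ (Fin m)) - MvPolynomial.C (α i) ∈
        quadraticModule h := by
    refine mem_quadraticModule_of_pos hArch _ fun x hx => ?_
    have h1 := hα i ⟨WithLp.toLp 2 x, hx⟩
    have h2 := minLoss_le g (WithLp.toLp 2 x) k
    have h3 := eval_sqDistPoly (ξhat i : EuclideanSpace ℝ (Fin m)) (WithLp.toLp 2 x)
    simp only [transportCost] at h1
    simp only [map_sub, map_add, map_mul, MvPolynomial.eval_C]
    change MvPolynomial.eval x _ = _ at h3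
    change _ ≤ MvPolynomial.eval x _ at h2
    rw [h3]
    linarith
  choose σ₀ σ hσ₀ hσ e using hQ
  refine ⟨∑ k, ∑ i, ((σ₀ k i).totalDegree + ∑ l, (σ k i l * h l).totalDegree),
    fun k l i => σ k i l, hlam, fun k l i => hσ k i l, fun k i => ?_, fun k l i => ?_⟩
  · rw [e k i, add_sub_cancel_right]
    refine ⟨hσ₀ k i, ?_⟩
    have h1 := Finset.single_le_sum_of_canonicallyOrdered (f := fun i =>
      (σ₀ k i).totalDegree + ∑ l, (σ k i l * h l).totalDegree) (Finset.mem_univ i)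
    have h2 := Finset.single_le_sum_of_canonicallyOrdered (f := fun k => ∑ i,
      ((σ₀ k i).totalDegree + ∑ l, (σ k i l * h l).totalDegree)) (Finset.mem_univ k)
    omega
  · have h0 := Finset.single_le_sum_of_canonicallyOrdered (f := fun l =>
      (σ k i l * h l).totalDegree) (Finset.mem_univ l)
    have h1 := Finset.single_le_sum_of_canonicallyOrdered (f := fun i =>
      (σ₀ k i).totalDegree + ∑ l, (σ k i l * h l).totalDegree) (Finset.mem_univ i)
    have h2 := Finset.single_le_sum_of_canonicallyOrdered (f := fun k => ∑ i,
      ((σ₀ k i).totalDegree + ∑ l, (σ k i l * h l).totalDegree)) (Finset.mem_univ k)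
    change (σ k i l * h l).totalDegree ≤ _
    omega

end WassersteinSOS

/-- For the loss `min_k g_k` on the Wasserstein ball of radius `ε > 0`: the expectation problem has
a minimum `v`, the values of the hierarchy increase with `r`, are at most `v`, and tend to `v`. -/
theorem corollary3p3 {m K L N : ℕ} (hK : 0 < K) (hN : 0 < N)
    (h : Fin L → MvPolynomial (Fin m) ℝ) (hArch : WassersteinSOS.ArchimedeanCondition h)
    (g : Fin K → MvPolynomial (Fin m) ℝ) (ξhat : Fin N → WassersteinSOS.supportSet h)
    (ε : ℝ) (hε : 0 < ε) :
    ∃ v : ℝ, IsLeast (WassersteinSOS.expectationValues h g ξhat ε) v ∧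
      (∀ r : ℕ,
        WassersteinSOS.hierarchyValue h g ξhat ε r ≤
            WassersteinSOS.hierarchyValue h g ξhat ε (r + 1) ∧
          WassersteinSOS.hierarchyValue h g ξhat ε (r + 1) ≤ (v : EReal)) ∧
      Tendsto (fun r : ℕ => WassersteinSOS.hierarchyValue h g ξhat ε r) atTop
        (𝓝 (v : EReal)) := by
  open WassersteinSOS in
  have : CompactSpace (supportSet h) := isCompact_iff_compactSpace.1 (isCompact_supportSet hArch)
  have : Nonempty (supportSet h) := ⟨ξhat ⟨0, hN⟩⟩
  have hN' : (N : ℝ) ≠ 0 := by exact_mod_cast hN.ne'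
  have hf : Continuous fun ξ : supportSet h => minLoss g ξ :=
    (continuous_minLoss hK g).comp continuous_subtype_val
  obtain ⟨γ, hγ, hγε, lam, hlam, hdual⟩ :=
    exists_coupling_and_multiplier hN hf ξhat (b := ε ^ 2) (by positivity)
  let Q : ProbabilityMeasure (supportSet h) := γ.map (f := Prod.fst) measurable_fst.aemeasurable
  have hQ : Q ∈ wassersteinBall ξhat ε := by
    change wassersteinDist _ _ ≤ _
    unfold wassersteinDist
    refine iInf₂_le_of_le (γ : Measure (supportSet h × supportSet h)) ⟨rfl, hγ⟩ ?_
    rw [lintegral_transportCost]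
    exact ENNReal.ofReal_le_ofReal ((Real.sqrt_le_left hε.le).2 hγε)
  have hint : ∫ ξ, minLoss g ξ ∂(Q : Measure (supportSet h)) =
      ∫ z, minLoss g z.1 ∂(γ : Measure (supportSet h × supportSet h)) :=
    integral_map measurable_fst.aemeasurable hf.aestronglyMeasurable
  set v : ℝ := ∫ ξ, minLoss g ξ ∂(Q : Measure (supportSet h))
  -- minimizers over `Ξ` of the dual constraint functions, one for each sample point
  have hcont (i : Fin N) : Continuous fun ξ : supportSet h =>
      minLoss g ξ + lam * transportCost (ξ, ξhat i) :=
    hf.add (continuous_const.mul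
      (continuous_transportCost.comp (continuous_id.prodMk continuous_const)))
  choose x hx using fun i => (hcont i).exists_forall_le (by simp)
  have hopt := hdual x
  rw [← hint] at hopt
  have hmin : v ∈ lowerBounds (expectationValues h g ξhat ε) := by
    rintro _ ⟨Q', hQ', rfl⟩
    exact hopt.trans (neg_mul_add_average_le_integral hN hf ξhat hε hQ' hlam hx)
  have hle (r : ℕ) : hierarchyValue h g ξhat ε r ≤ (v : EReal) := by
    refine sSup_le ?_
    rintro _ ⟨lam', α, σ, hF, rfl⟩
    exact EReal.coe_le_coe_iff.2
      (neg_mul_add_average_le_integral hN hf ξhat hε hQ hF.1 (hF.le_minLoss_add hK))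
  refine ⟨v, ⟨⟨Q, hQ, rfl⟩, hmin⟩,
    fun r => ⟨hierarchyValue_mono h g ξhat ε r.le_succ, hle (r + 1)⟩, ?_⟩
  refine tendsto_order.2 ⟨fun b hb => ?_, fun b hb => Eventually.of_forall fun r =>
    (hle r).trans_lt hb⟩
  obtain ⟨w, hbw, hwv⟩ := EReal.lt_iff_exists_real_btwn.1 hb
  have hwv' : w < v := EReal.coe_lt_coe_iff.1 hwv
  -- lower each optimal `αᵢ` by `v - w` to make the dual constraints strict
  obtain ⟨r, σ, hF⟩ := exists_isFeasible_of_lt hArch g ξhat hlam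
    (α := fun i => minLoss g (x i) + lam * transportCost (x i, ξhat i) - (v - w))
    fun i ξ => by linarith [hx i ξ]
  filter_upwards [eventually_ge_atTop r] with s hs
  refine hbw.trans_le (le_trans ?_ (hierarchyValue_mono h g ξhat ε hs))
  refine le_trans (EReal.coe_le_coe_iff.2 ?_) (le_sSup ⟨lam, _, σ, hF, rfl⟩)
  rw [Finset.sum_sub_distrib, mul_sub]
  simp only [Finset.sum_const, Finset.card_univ, Fintype.card_fin, nsmul_eq_mul]
  rw [← mul_assoc, one_div_mul_cancel hN', one_mul]
  linarith
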